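/- Let $k$ be a field and let $m \ge 2$ be an integer. Let $\mathfrak{S}_m \subseteq \mathbb{N}$ be the numerical semigroup generated by $$n_1 = m(m+1),\quad n_2 = m(m+1)+1,\quad n_3 = (m+1)^2,\quad n_4 = (m+1)^2+1,$$ let $R = k[[t^{n_1},t^{n_2},t^{n_3},t^{n_4}]] \subseteq k[[t]]$ be the ring of power series whose exponents all lie in $\mathfrak{S}_m$ (the local ring at the origin of the Arslan curve), and let $\mathfrak{m}$ be its maximal ideal. Then the tangent cone $$G_{\mathfrak{m}}(\mathfrak{S}_m) = \bigoplus_{i \ge 0} \mathfrak{m}^i/\mathfrak{m}^{i+1}$$ is a Cohen–Macaulay ring; that is, it is Noetherian and each of its localizations at a prime ideal has depth equal to its Krull dimension. -/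

import Mathlib

/-- The semigroup ring `k⟦S⟧` of a submonoid `S` of `(ℕ, +)`: the subalgebra of `k⟦t⟧` of the power
series all of whose exponents lie in `S`. For `S = ⟨a₁, …, aₑ⟩` this is `k⟦t ^ a₁, …, t ^ aₑ⟧`. -/
def semigroupRing (k : Type*) [Field k] (S : AddSubmonoid ℕ) : Subalgebra k (PowerSeries k) where
  carrier := {f | ∀ n, n ∉ S → PowerSeries.coeff n f = 0}
  mul_mem' {f g} hf hg n hn := by
    rw [PowerSeries.coeff_mul]
    refine Finset.sum_eq_zero fun p hp => ?_
    rw [Finset.HasAntidiagonal.mem_antidiagonal] at hp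
    by_cases h1 : p.1 ∈ S
    · by_cases h2 : p.2 ∈ S
      · exact absurd (hp ▸ S.add_mem h1 h2) hn
      · rw [hg _ h2, mul_zero]
    · rw [hf _ h1, zero_mul]
  add_mem' {f g} hf hg n hn := by
    rw [map_add, hf n hn, hg n hn, add_zero]
  algebraMap_mem' r n hn := by
    have h0 : n ≠ 0 := fun h => hn (h ▸ S.zero_mem)
    rw [PowerSeries.algebraMap_apply, PowerSeries.coeff_C, if_neg h0]

theorem semigroupRing_mem_iff {k : Type*} [Field k] {S : AddSubmonoid ℕ} {f : PowerSeries k} :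
    f ∈ semigroupRing k S ↔ ∀ n, n ∉ S → PowerSeries.coeff n f = 0 :=
  Iff.rfl

theorem semigroupRing_mem_of_mul_eq_one {k : Type*} [Field k] {S : AddSubmonoid ℕ}
    {f g : PowerSeries k} (hf : f ∈ semigroupRing k S) (h : f * g = 1) :
    g ∈ semigroupRing k S := by
  have h0 : PowerSeries.coeff 0 f ≠ 0 := by
    intro h0
    have h1 := congrArg (PowerSeries.coeff 0) h
    rw [PowerSeries.coeff_mul] at h1
    simp [h0] at h1
  intro n
  induction n using Nat.strong_induction_on with
  | _ n ih =>
    intro hn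
    have hn0 : n ≠ 0 := fun e => hn (e ▸ S.zero_mem)
    have h1 := congrArg (PowerSeries.coeff n) h
    rw [PowerSeries.coeff_mul, PowerSeries.coeff_one, if_neg hn0,
      Finset.sum_eq_single (0, n)] at h1
    · exact (mul_eq_zero.mp h1).resolve_left h0
    · rintro ⟨i, j⟩ hp hne
      rw [Finset.HasAntidiagonal.mem_antidiagonal] at hp
      simp only at hp ⊢
      by_cases hi : i ∈ S
      · have hj : j ∉ S := fun hj => hn (hp ▸ S.add_mem hi hj)
        have hi0 : i ≠ 0 := by
          rintro rfl
          exact hne (by simp at hp; simp [hp])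
        rw [ih j (by omega) hj, mul_zero]
      · rw [hf i hi, zero_mul]
    · intro hne
      exact absurd (by simp) hne

instance semigroupRing.isLocalRing (k : Type*) [Field k] (S : AddSubmonoid ℕ) :
    IsLocalRing (semigroupRing k S) := by
  have : IsLocalHom (semigroupRing k S).val.toRingHom := by
    refine ⟨fun a ha => ?_⟩
    obtain ⟨g, hg⟩ := ha.exists_right_inv
    have hg' : (a : PowerSeries k) * g = 1 := hg
    exact IsUnit.of_mul_eq_one ⟨g, semigroupRing_mem_of_mul_eq_one a.2 hg'⟩ (Subtype.ext hg')
  exact RingHom.domain_isLocalRing (semigroupRing k S).val.toRingHom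

/-- In the Rees algebra `⨁ₙ Iⁿ Xⁿ`, the ideal `⨁ₙ Iⁿ⁺¹ Xⁿ`. -/
def reesShiftIdeal {R : Type*} [CommRing R] (I : Ideal R) : Ideal (reesAlgebra I) where
  carrier := {f | ∀ n, (f : Polynomial R).coeff n ∈ I ^ (n + 1)}
  add_mem' {f g} hf hg n := by
    simpa using (I ^ (n + 1)).add_mem (hf n) (hg n)
  zero_mem' n := by simp
  smul_mem' f g hg n := by
    simp only [smul_eq_mul, MulMemClass.coe_mul, Polynomial.coeff_mul]
    refine Ideal.sum_mem _ fun p hp => ?_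
    rw [Finset.HasAntidiagonal.mem_antidiagonal] at hp
    rw [← hp, add_assoc, pow_add]
    exact Ideal.mul_mem_mul (f.2 p.1) (hg p.2)

/-- The associated graded ring `gr_I(R) = ⨁ₙ Iⁿ / Iⁿ⁺¹`, as the quotient of the Rees algebra
`⨁ₙ Iⁿ Xⁿ` by its ideal `⨁ₙ Iⁿ⁺¹ Xⁿ`; thus the product of the classes of `a ∈ Iⁱ` and `b ∈ Iʲ` in
degrees `i` and `j` is the class of `a * b` in degree `i + j`. -/
abbrev AssociatedGradedRing {R : Type*} [CommRing R] (I : Ideal R) : Type _ :=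
  reesAlgebra I ⧸ reesShiftIdeal I

/-- The tangent cone `G_𝔪(R) = ⨁ₙ 𝔪ⁿ / 𝔪ⁿ⁺¹` of a local ring `(R, 𝔪)`. -/
abbrev TangentCone (R : Type*) [CommRing R] [IsLocalRing R] : Type _ :=
  AssociatedGradedRing (IsLocalRing.maximalIdeal R)

/-- The depth of a local ring: the supremum of the lengths of the regular sequences in its
maximal ideal. -/
noncomputable def localRingDepth (R : Type*) [CommRing R] [IsLocalRing R] : ℕ∞ :=
  ⨆ (rs : List R) (_ : ∀ r ∈ rs, r ∈ IsLocalRing.maximalIdeal R)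
    (_ : RingTheory.Sequence.IsRegular R rs), (rs.length : ℕ∞)

/-- A Noetherian local ring is Cohen–Macaulay if its depth equals its Krull dimension. -/
def IsCohenMacaulayLocalRing (R : Type*) [CommRing R] [IsLocalRing R] : Prop :=
  IsNoetherianRing R ∧ (localRingDepth R : WithBot ℕ∞) = ringKrullDim R

/-- A ring is Cohen–Macaulay if it is Noetherian and all its local rings are Cohen–Macaulay. -/
def IsCohenMacaulayRing (R : Type*) [CommRing R] : Prop :=
  IsNoetherianRing R ∧
    ∀ (p : Ideal R) [p.IsPrime], IsCohenMacaulayLocalRing (Localization.AtPrime p)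

/-- The Arslan semigroup `𝔖ₘ = ⟨m(m+1), m(m+1)+1, (m+1)², (m+1)²+1⟩`. -/
def arslanSemigroup (m : ℕ) : AddSubmonoid ℕ :=
  AddSubmonoid.closure {m * (m + 1), m * (m + 1) + 1, (m + 1) ^ 2, (m + 1) ^ 2 + 1}

/-! Write `d = m(m+1)` for the multiplicity. The arithmetic core,
`exists_le_add_of_mem_arslanSemigroup`, makes `𝔪ⁱ` exactly the set of series in `R` of order at
least `i * d` (`mem_maximalIdeal_pow_iff`). Dividing by `t ^ d` therefore lowers the `𝔪`-adic
filtration by exactly one step, so the initial form of `t ^ d` is a nonzerodivisor on the tangent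
cone, and so is every nonzero polynomial in it over `k`. The initial forms of the other generators
are nilpotent. Hence the tangent cone is integral and torsion-free over `k[X]`, with `X` acting as
the initial form of `t ^ d`, and a Noetherian ring of this kind over a domain of dimension at most
one is Cohen–Macaulay (`IsCohenMacaulayRing.of_isIntegral`). -/

/-! ### Cohen–Macaulay criteria in dimension at most one -/

theorem localRingDepth_le_ringKrullDim (R : Type*) [CommRing R] [IsLocalRing R]
    [IsNoetherianRing R] : (localRingDepth R : WithBot ℕ∞) ≤ ringKrullDim R := by
  obtain ⟨n, hn⟩ := WithBot.ne_bot_iff_exists.mp (ringKrullDim_ne_bot (R := R))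
  rw [← hn, WithBot.coe_le_coe, localRingDepth]
  refine iSup_le fun rs => iSup_le fun _ => iSup_le fun hreg => ?_
  rw [← WithBot.coe_le_coe, hn, ← ringKrullDim_add_length_eq_ringKrullDim_of_isRegular rs hreg]
  have hnt : Nontrivial (R ⧸ Ideal.ofList rs) := by
    rw [Ideal.Quotient.nontrivial_iff]
    simpa using hreg.top_ne_smul.symm
  exact le_add_of_nonneg_left ringKrullDim_nonneg_of_nontrivial

theorem one_le_localRingDepth {R : Type*} [CommRing R] [IsLocalRing R] {r : R}
    (hr : r ∈ IsLocalRing.maximalIdeal R) (hreg : r ∈ nonZeroDivisors R) :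
    1 ≤ localRingDepth R := by
  have h : RingTheory.Sequence.IsRegular R [r] := by
    rw [IsLocalRing.isRegular_iff_isWeaklyRegular_of_subset_maximalIdeal (by simpa using hr),
      RingTheory.Sequence.isWeaklyRegular_singleton_iff]
    intro a b hab
    exact mul_cancel_left_mem_nonZeroDivisors hreg |>.mp hab
  refine le_iSup_of_le [r] (le_iSup_of_le (by simpa using hr) (le_iSup_of_le h ?_))
  simp

theorem IsCohenMacaulayLocalRing.of_ringKrullDim_le_one {R : Type*} [CommRing R] [IsLocalRing R]
    [IsNoetherianRing R] (hdim : ringKrullDim R ≤ 1)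
    (h : ringKrullDim R = 0 ∨ ∃ r ∈ IsLocalRing.maximalIdeal R, r ∈ nonZeroDivisors R) :
    IsCohenMacaulayLocalRing R := by
  refine ⟨inferInstance, le_antisymm (localRingDepth_le_ringKrullDim R) ?_⟩
  obtain h | ⟨r, hr, hreg⟩ := h
  · rw [h]
    exact WithBot.coe_le_coe.mpr zero_le
  · exact hdim.trans (WithBot.coe_le_coe.mpr (one_le_localRingDepth hr hreg))

/-- A Noetherian ring which is integral and torsion-free over a domain of dimension at most one
is Cohen–Macaulay. -/
theorem IsCohenMacaulayRing.of_isIntegral (A : Type*) {B : Type*} [CommRing A] [IsDomain A]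
    [CommRing B] [Algebra A B] [IsNoetherianRing B] [Algebra.IsIntegral A B]
    (hdim : ringKrullDim A ≤ 1)
    (hreg : ∀ a : A, a ≠ 0 → algebraMap A B a ∈ nonZeroDivisors B) : IsCohenMacaulayRing B := by
  refine ⟨inferInstance, fun p _ => ?_⟩
  have hmono : StrictMono (PrimeSpectrum.comap (algebraMap A B)) := fun I J hIJ =>
    Ideal.IsIntegral.comap_lt_comap (I := I.asIdeal) (J := J.asIdeal) hIJ
  have : IsNoetherianRing (Localization.AtPrime p) :=
    IsLocalization.isNoetherianRing p.primeCompl _ inferInstance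
  have hheight : ringKrullDim (Localization.AtPrime p) = p.height :=
    IsLocalization.AtPrime.ringKrullDim_eq_height p _
  refine .of_ringKrullDim_le_one ?_ ?_
  · rw [hheight]
    exact (Ideal.height_le_ringKrullDim_of_ne_top Ideal.IsPrime.ne_top').trans
      ((Order.krullDim_le_of_strictMono _ hmono).trans hdim)
  -- By incomparability, a prime over `⊥` is minimal, so its local ring has dimension 0. Any other
  -- prime contains the image of some `a ≠ 0`, which stays a nonzerodivisor after localization.
  · by_cases hp : p.comap (algebraMap A B) = ⊥
    · left
      have hmin : p ∈ minimalPrimes B := by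
        refine ⟨⟨inferInstance, bot_le⟩, fun q hq hqp => ?_⟩
        by_contra hpq
        have := hq.1
        have hlt := Ideal.IsIntegral.comap_lt_comap (R := A) (lt_of_le_not_ge hqp hpq)
        exact not_lt_bot (hp ▸ hlt)
      rw [hheight, Ideal.height_eq_zero_iff.mpr hmin]
      rfl
    · right
      obtain ⟨a, ha, ha0⟩ := (Submodule.ne_bot_iff _).mp hp
      refine ⟨algebraMap B _ (algebraMap A B a), ?_, ?_⟩
      · exact (IsLocalization.AtPrime.to_map_mem_maximal_iff _ p _).mpr ha
      · exact IsLocalization.map_nonZeroDivisors_le p.primeCompl _ ⟨_, hreg a ha0, rfl⟩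

/-- A ring generated over a Noetherian domain of dimension at most one by finitely many integral
elements is Cohen–Macaulay if the nonzero elements of the domain are nonzerodivisors on it. -/
theorem IsCohenMacaulayRing.of_generators {A B : Type*} [CommRing A] [IsDomain A]
    [IsNoetherianRing A] [CommRing B] (φ : A →+* B) (hdim : ringKrullDim A ≤ 1) {Y : Set B}
    (hfin : Y.Finite) (hint : ∀ y ∈ Y, φ.IsIntegralElem y)
    (htop : ∀ T : Subring B, (∀ a, φ a ∈ T) → (∀ y ∈ Y, y ∈ T) → T = ⊤)
    (hreg : ∀ a : A, a ≠ 0 → ∀ b, φ a * b = 0 → b = 0) : IsCohenMacaulayRing B := by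
  algebraize [φ]
  have h : ∀ C : Subalgebra A B, Y ⊆ C → C = ⊤ := fun C hC => by
    have := htop C.toSubring (fun a => C.algebraMap_mem a) hC
    rw [← Algebra.toSubring_eq_top]
    exact this
  have : Algebra.IsIntegral A B := by
    rw [← integralClosure_eq_top_iff]
    exact h _ hint
  have : Algebra.FiniteType A B :=
    ⟨Subalgebra.fg_def.mpr ⟨Y, hfin, h _ Algebra.subset_adjoin⟩⟩
  have := Algebra.FiniteType.isNoetherianRing A B
  refine .of_isIntegral A hdim fun a ha => ?_
  rw [mem_nonZeroDivisors_iff_right]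
  exact fun b hb => hreg a ha b (by rwa [mul_comm])

/-! ### Associated graded rings -/

section TangentCone

open Polynomial

/-- A subring of the associated graded ring that contains the constants and the initial forms of
generators of the ideal is everything. -/
theorem AssociatedGradedRing.subring_eq_top {R : Type*} [CommRing R] {I : Ideal R} {s : Set R}
    (hs : I = Ideal.span s) (T : Subring (AssociatedGradedRing I))
    (h0 : ∀ r : R, Ideal.Quotient.mk (reesShiftIdeal I) (algebraMap R (reesAlgebra I) r) ∈ T)
    (h1 : ∀ f : reesAlgebra I, (∃ a ∈ s, (f : R[X]) = monomial 1 a) →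
      Ideal.Quotient.mk (reesShiftIdeal I) f ∈ T) : T = ⊤ := by
  have hlin : ∀ a ∈ I, ∃ h : monomial 1 a ∈ reesAlgebra I,
      Ideal.Quotient.mk (reesShiftIdeal I) ⟨monomial 1 a, h⟩ ∈ T := by
    intro a ha
    rw [hs] at ha
    induction ha using Submodule.span_induction with
    | mem a ha =>
      have h : monomial 1 a ∈ reesAlgebra I :=
        reesAlgebra.monomial_mem.mpr (by rw [pow_one, hs]; exact Ideal.subset_span ha)
      exact ⟨h, h1 ⟨_, h⟩ ⟨a, ha, rfl⟩⟩
    | zero =>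
      refine ⟨by simp, ?_⟩
      convert T.zero_mem
      rw [← map_zero (Ideal.Quotient.mk (reesShiftIdeal I))]
      congr 1
      ext1
      simp
    | add a b _ _ ha hb =>
      obtain ⟨ha, ha'⟩ := ha
      obtain ⟨hb, hb'⟩ := hb
      refine ⟨by rw [map_add]; exact add_mem ha hb, ?_⟩
      convert T.add_mem ha' hb'
      rw [← RingHom.map_add]
      congr 1
      ext1
      simp
    | smul r a _ ha =>
      obtain ⟨ha, ha'⟩ := ha
      have he : monomial 1 (r • a) = (algebraMap R (reesAlgebra I) r : R[X]) * monomial 1 a := by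
        rw [← smul_monomial, Polynomial.smul_eq_C_mul]
        rfl
      refine ⟨by rw [he]; exact mul_mem (Subtype.prop _) ha, ?_⟩
      convert T.mul_mem (h0 r) ha'
      rw [← map_mul]
      congr 1
      ext1
      exact he
  rw [eq_top_iff]
  rintro x -
  obtain ⟨⟨f, hf⟩, rfl⟩ := Ideal.Quotient.mk_surjective x
  suffices ∃ h : f ∈ reesAlgebra I, Ideal.Quotient.mk (reesShiftIdeal I) ⟨f, h⟩ ∈ T from this.2
  rw [← adjoin_monomial_eq_reesAlgebra] at hf
  induction hf using Algebra.adjoin_induction with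
  | mem f hf =>
    obtain ⟨a, ha, rfl⟩ := hf
    exact hlin a ha
  | algebraMap r => exact ⟨Subalgebra.algebraMap_mem _ r, h0 r⟩
  | add f g _ _ hf hg =>
    obtain ⟨hf, hf'⟩ := hf
    obtain ⟨hg, hg'⟩ := hg
    exact ⟨add_mem hf hg, T.add_mem hf' hg'⟩
  | mul f g _ _ hf hg =>
    obtain ⟨hf, hf'⟩ := hf
    obtain ⟨hg, hg'⟩ := hg
    exact ⟨mul_mem hf hg, T.mul_mem hf' hg'⟩

/-- If multiplication by `x ∈ I` is injective on initial forms, then nonzero polynomials over `k` in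
the initial form of `x` act injectively on the associated graded ring. -/
theorem reesShiftIdeal_mem_of_eval₂_mul_mem {k R : Type*} [Field k] [CommRing R] [Algebra k R]
    {I : Ideal R} {x : R} (hx : x ∈ I)
    (hreg : ∀ (i : ℕ) (a : R), x * a ∈ I ^ (i + 1) → a ∈ I ^ i)
    {P : k[X]} (hP : P ≠ 0) {f : R[X]}
    (h : ∀ n, (P.eval₂ (algebraMap k R[X]) (monomial 1 x) * f).coeff n ∈ I ^ (n + 1)) (n : ℕ) :
    f.coeff n ∈ I ^ (n + 1) := by
  induction n using Nat.strong_induction_on with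
  | _ n ih =>
  have hcoeff : ∀ a, (P.eval₂ (algebraMap k R[X]) (monomial 1 x)).coeff a
      = algebraMap k R (P.coeff a) * x ^ a := by
    intro a
    rw [eval₂_eq_sum, Polynomial.sum, finsetSum_coeff, Finset.sum_eq_single a]
    · rw [monomial_pow, one_mul, Polynomial.algebraMap_apply, coeff_C_mul, coeff_monomial, if_pos rfl]
    · intro b _ hb
      rw [monomial_pow, one_mul, Polynomial.algebraMap_apply, coeff_C_mul, coeff_monomial, if_neg hb,
        mul_zero]
    · intro ha
      rw [notMem_support_iff.mp ha]
      simp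
  -- In the coefficient of degree `j + n`, the terms with first index below `j` vanish and those
  -- above `j` are controlled by induction; only the lowest term of `P` times `f.coeff n` remains.
  set j := P.natTrailingDegree with hj
  have hregpow : ∀ (j i : ℕ) (a : R), x ^ j * a ∈ I ^ (i + j) → a ∈ I ^ i := by
    intro j
    induction j with
    | zero => intro i a h; simpa using h
    | succ j ihj =>
      intro i a h
      refine hreg i a (ihj (i + 1) _ ?_)
      rwa [← mul_assoc, ← pow_succ, add_right_comm, add_assoc]
  refine hregpow j _ _ ?_
  have hunit : IsUnit (algebraMap k R (P.coeff j)) :=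
    (IsUnit.mk0 _ (by simpa [hj] using! hP)).map _
  rw [← Ideal.unit_mul_mem_iff_mem _ hunit, ← mul_assoc]
  have hn := h (j + n)
  rw [coeff_mul, ← Finset.add_sum_erase _ _ (show (j, n) ∈ Finset.HasAntidiagonal.antidiagonal (j + n) by simp),
    hcoeff] at hn
  rw [show n + 1 + j = j + n + 1 by ring]
  refine (Ideal.add_mem_iff_left _ (Ideal.sum_mem _ ?_)).mp hn
  rintro ⟨a, b⟩ hab
  rw [Finset.mem_erase, Finset.HasAntidiagonal.mem_antidiagonal] at hab
  obtain ⟨hne, hab⟩ := hab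
  simp only at hab ⊢
  rw [hcoeff]
  rcases lt_or_ge a j with ha | ha
  · rw [coeff_eq_zero_of_lt_natTrailingDegree ha]
    simp
  · have hb : b < n := by
      rcases lt_or_eq_of_le ha with h' | h'
      · omega
      · exact absurd (Prod.ext h'.symm (by simp only; omega)) hne
    rw [← hab, add_assoc, pow_add, mul_assoc]
    exact Ideal.mul_mem_left _ _ (Ideal.mul_mem_mul (Ideal.pow_mem_pow hx a) (ih b hb))

/-- The monomial `t ^ n` of a semigroup ring. -/
noncomputable def semigroupRing.single (k : Type*) [Field k] {S : AddSubmonoid ℕ} {n : ℕ}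
    (hn : n ∈ S) : semigroupRing k S :=
  ⟨PowerSeries.X ^ n, fun i hi => by
    rw [PowerSeries.coeff_X_pow, if_neg]
    rintro rfl
    exact hi hn⟩

/-! ### Order filtration and tangent cone of a semigroup ring -/

namespace semigroupRing

variable {k : Type*} [Field k] {S : AddSubmonoid ℕ}

theorem mem_maximalIdeal_iff {f : semigroupRing k S} :
    f ∈ IsLocalRing.maximalIdeal (semigroupRing k S) ↔
      PowerSeries.coeff 0 (f : PowerSeries k) = 0 := by
  rw [IsLocalRing.mem_maximalIdeal, mem_nonunits_iff, not_iff_comm]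
  constructor
  · intro h
    have hu : (f : PowerSeries k) * (f : PowerSeries k)⁻¹ = 1 :=
      PowerSeries.mul_inv_cancel _ (by simpa using h)
    exact IsUnit.of_mul_eq_one ⟨_, semigroupRing_mem_of_mul_eq_one f.2 hu⟩ (Subtype.ext hu)
  · intro h h0
    have := (h.map (semigroupRing k S).val).map (PowerSeries.constantCoeff (R := k))
    simp at h0
    simp [h0] at this

/-- Each exponent `n ≥ c` in `S` is assigned one generator `J n`; then `h j` collects the terms of
`f` assigned to `j`, shifted down by `g j`. -/
theorem exists_eq_sum_single_mul {ι : Type*} [Fintype ι] {g : ι → ℕ} (hg : ∀ j, g j ∈ S)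
    {c d : ℕ} (hS : ∀ n ∈ S, c ≤ n → ∃ j, ∃ s ∈ S, n = g j + s ∧ d ≤ s) {f : semigroupRing k S}
    (hf : ∀ n < c, PowerSeries.coeff n (f : PowerSeries k) = 0) :
    ∃ h : ι → semigroupRing k S,
      (∀ j, ∀ n < d, PowerSeries.coeff n (h j : PowerSeries k) = 0) ∧
      f = ∑ j, single k (hg j) * h j := by
  classical
  have hS' : ∀ n : {n // n ∈ S ∧ c ≤ n}, ∃ j, ∃ s ∈ S, (n : ℕ) = g j + s ∧ d ≤ s :=
    fun n => hS n n.2.1 n.2.2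
  choose J t ht hJt hdt using hS'
  have hf0 : ∀ n, ¬ (n ∈ S ∧ c ≤ n) → PowerSeries.coeff n (f : PowerSeries k) = 0 := by
    intro n hn
    by_cases h1 : n ∈ S
    · exact hf n (by by_contra h2; exact hn ⟨h1, by omega⟩)
    · exact f.2 n h1
  refine ⟨fun j => ⟨PowerSeries.mk fun s =>
    if s ∈ S ∧ d ≤ s ∧ ∃ h : g j + s ∈ S ∧ c ≤ g j + s, J ⟨g j + s, h⟩ = j then
      PowerSeries.coeff (g j + s) (f : PowerSeries k) else 0, ?_⟩, ?_, ?_⟩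
  · intro n hn
    rw [PowerSeries.coeff_mk, if_neg fun h => hn h.1]
  · intro j n hn
    rw [PowerSeries.coeff_mk, if_neg fun h => by omega]
  · ext n
    rw [AddSubmonoidClass.coe_finsetSum, map_sum]
    simp only [MulMemClass.coe_mul, single, PowerSeries.coeff_X_pow_mul', PowerSeries.coeff_mk]
    by_cases hn : n ∈ S ∧ c ≤ n
    · rw [Finset.sum_eq_single (J ⟨n, hn⟩)]
      · have h1 := hJt ⟨n, hn⟩
        simp only at h1
        have h2 : n - g (J ⟨n, hn⟩) = t ⟨n, hn⟩ := by omega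
        have h3 : g (J ⟨n, hn⟩) + t ⟨n, hn⟩ = n := h1.symm
        rw [if_pos (by omega), h2, if_pos, h3]
        refine ⟨ht _, hdt _, by rwa [h3], ?_⟩
        congr 1
        exact Subtype.ext h3
      · intro j _ hj
        split_ifs with h1 h2
        · obtain ⟨-, -, h, h2⟩ := h2
          refine absurd ?_ hj
          rw [← h2]
          congr 1
          exact Subtype.ext (by simp only; omega)
        · rfl
        · rfl
      · simp
    · rw [hf0 n hn, Finset.sum_eq_zero]
      intro j _
      split_ifs with h1 h2
      · rw [Nat.add_sub_cancel' h1, hf0 n hn]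
      · rfl
      · rfl

/-- Orders add under multiplication and nonunits have order at least `d`. Conversely, `hS` splits
off a generator at the cost of only `d` in the order bound, and induction on `i` applies. -/
theorem mem_maximalIdeal_pow_iff {ι : Type*} [Fintype ι] {g : ι → ℕ} (hg : ∀ j, g j ∈ S)
    {d : ℕ} (hd : 0 < d) (hdg : ∀ j, d ≤ g j) (hdS : ∀ n ∈ S, n ≠ 0 → d ≤ n)
    (hS : ∀ i, ∀ n ∈ S, (i + 1) * d ≤ n → ∃ j, ∃ s ∈ S, n = g j + s ∧ i * d ≤ s)
    {i : ℕ} {f : semigroupRing k S} :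
    f ∈ IsLocalRing.maximalIdeal (semigroupRing k S) ^ i ↔
      ∀ n < i * d, PowerSeries.coeff n (f : PowerSeries k) = 0 := by
  constructor
  · induction i generalizing f with
    | zero => simp
    | succ i ih =>
      intro hf
      rw [pow_succ'] at hf
      induction hf using Submodule.mul_induction_on' with
      | mem_mul_mem a ha b hb =>
        intro n hn
        rw [MulMemClass.coe_mul, PowerSeries.coeff_mul]
        refine Finset.sum_eq_zero fun p hp => ?_
        rw [Finset.HasAntidiagonal.mem_antidiagonal] at hp
        rcases lt_or_ge p.2 (i * d) with h | h
        · rw [ih hb _ h, mul_zero]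
        · have hpd : p.1 < d := by rw [add_mul, one_mul] at hn; omega
          suffices PowerSeries.coeff p.1 (a : PowerSeries k) = 0 by rw [this, zero_mul]
          by_cases h0 : p.1 = 0
          · rw [h0]
            exact mem_maximalIdeal_iff.mp ha
          · exact a.2 _ fun h => absurd (hdS _ h h0) (by omega)
      | add a _ b _ ha hb =>
        intro n hn
        rw [AddMemClass.coe_add, map_add, ha n hn, hb n hn, add_zero]
  · induction i generalizing f with
    | zero => simp
    | succ i ih =>
      intro hf
      obtain ⟨h, hh, rfl⟩ := exists_eq_sum_single_mul hg (hS i) hf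
      rw [pow_succ']
      refine Ideal.sum_mem _ fun j _ => Ideal.mul_mem_mul ?_ (ih (hh j))
      rw [mem_maximalIdeal_iff, single, PowerSeries.coeff_X_pow, if_neg]
      have := hdg j
      omega

/-- If an element of `S` that is at least `(i + 1) * d` is the sum of a generator and an element
that is at least `i * d`, then the tangent cone of the semigroup ring is Cohen–Macaulay. -/
theorem isCohenMacaulayRing_tangentCone {ι : Type*} [Fintype ι] {g : ι → ℕ} (hg : ∀ j, g j ∈ S)
    {d : ℕ} (hd : 0 < d) (hd' : d ∈ S) (hdg : ∀ j, d ≤ g j) (hdS : ∀ n ∈ S, n ≠ 0 → d ≤ n)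
    (hS : ∀ i, ∀ n ∈ S, (i + 1) * d ≤ n → ∃ j, ∃ s ∈ S, n = g j + s ∧ i * d ≤ s) :
    IsCohenMacaulayRing (TangentCone (semigroupRing k S)) := by
  set I := IsLocalRing.maximalIdeal (semigroupRing k S) with hI
  have hpow {i : ℕ} {f : semigroupRing k S} :
      f ∈ I ^ i ↔ ∀ n < i * d, PowerSeries.coeff n (f : PowerSeries k) = 0 :=
    mem_maximalIdeal_pow_iff hg hd hdg hdS hS
  have hsingle {n : ℕ} (hn : n ∈ S) (h0 : d ≤ n) : single k hn ∈ I := by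
    rw [hI, mem_maximalIdeal_iff, single, PowerSeries.coeff_X_pow, if_neg (by omega)]
  let lin {a : semigroupRing k S} (ha : a ∈ I) : reesAlgebra I :=
    ⟨monomial 1 a, reesAlgebra.monomial_mem.mpr (by rwa [pow_one])⟩
  let φ₀ : k[X] →+* reesAlgebra I :=
    eval₂RingHom ((algebraMap (semigroupRing k S) (reesAlgebra I)).comp (algebraMap k _))
      (lin (hsingle hd' le_rfl))
  have hφ₀ : ∀ P : k[X], (φ₀ P : (semigroupRing k S)[X])
      = P.eval₂ (algebraMap k _) (monomial 1 (single k hd')) := by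
    intro P
    exact Polynomial.hom_eval₂ P _ (reesAlgebra I).val.toRingHom _
  let mk := Ideal.Quotient.mk (reesShiftIdeal I)
  let φ : k[X] →+* TangentCone (semigroupRing k S) := mk.comp φ₀
  let Y : ι → TangentCone (semigroupRing k S) := fun j => mk (lin (hsingle (hg j) (hdg j)))
  have hspan : I = Ideal.span (Set.range fun j => single k (hg j)) := by
    apply le_antisymm
    · intro f hf
      rw [← pow_one I, hpow] at hf
      obtain ⟨h, -, rfl⟩ := exists_eq_sum_single_mul hg (hS 0) (by simpa using hf)
      exact Ideal.sum_mem _ fun j _ =>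
        Ideal.mul_mem_right _ _ (Ideal.subset_span (Set.mem_range_self j))
    · rw [Ideal.span_le]
      rintro _ ⟨j, rfl⟩
      exact hsingle (hg j) (hdg j)
  refine .of_generators φ ?_ (Set.finite_range Y) ?_ ?_ ?_
  · rw [ringKrullDim_of_isNoetherianRing, ringKrullDim_eq_zero_of_field, zero_add]
  · rintro _ ⟨j, rfl⟩
    rcases (hdg j).eq_or_lt with h | h
    · have : Y j = φ X := by
        change _ = mk (φ₀ X)
        rw [coe_eval₂RingHom, eval₂_X]
        refine congrArg mk (Subtype.ext ?_)
        change monomial 1 (single k _) = monomial 1 (single k _)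
        congr 1
        ext1
        simp only [single, h]
      rw [this]
      exact φ.isIntegralElem_map
    -- Since `g j ≥ d + 1`, the exponent `g j * d` is at least `(d + 1) * d`, so the power lies in
    -- `I ^ (d + 1)` and dies in degree `d`.
    · have : Y j ^ d = 0 := by
        change mk _ ^ d = 0
        rw [← map_pow, Ideal.Quotient.eq_zero_iff_mem]
        intro n
        change ((monomial 1 (single k (hg j))) ^ d).coeff n ∈ _
        rw [monomial_pow, one_mul, coeff_monomial]
        split_ifs with hn
        · rw [← hn, hpow]
          intro i hi
          change PowerSeries.coeff i ((PowerSeries.X ^ g j) ^ d) = 0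
          rw [← pow_mul, PowerSeries.coeff_X_pow, if_neg]
          have := Nat.mul_le_mul_right d (Nat.succ_le_of_lt h)
          rw [Nat.succ_eq_add_one] at this
          omega
        · exact zero_mem _
      exact ⟨X ^ d, monic_X_pow d, by rw [eval₂_X_pow, this]⟩
  · intro T hφ hY
    refine AssociatedGradedRing.subring_eq_top hspan T ?_ ?_
    · intro r
      let c := PowerSeries.coeff 0 (r : PowerSeries k)
      -- The residue field is `k`: in degree zero only the constant term of `r` survives.
      have : mk (algebraMap _ (reesAlgebra I) r) = φ (C c) := by
        change _ = mk (φ₀ (C c))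
        rw [Ideal.Quotient.eq, coe_eval₂RingHom, eval₂_C, RingHom.comp_apply, ← map_sub]
        intro n
        change (C (r - algebraMap k _ c)).coeff n ∈ _
        rw [coeff_C]
        split_ifs with h0
        · rw [h0, zero_add, pow_one, hI, mem_maximalIdeal_iff]
          change PowerSeries.coeff 0 ((r : PowerSeries k) - algebraMap k _ c) = 0
          rw [map_sub, PowerSeries.algebraMap_apply, PowerSeries.coeff_C, if_pos rfl]
          exact sub_self c
        · exact zero_mem _
      change mk _ ∈ T
      rw [this]
      exact hφ _
    · rintro f ⟨_, ⟨j, rfl⟩, hf⟩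
      have : mk f = Y j := congrArg mk (Subtype.ext hf)
      change mk f ∈ T
      rw [this]
      exact hY _ ⟨j, rfl⟩
  · intro P hP z hz
    obtain ⟨f, rfl⟩ := Ideal.Quotient.mk_surjective z
    change mk (φ₀ P) * mk f = 0 at hz
    rw [← map_mul, Ideal.Quotient.eq_zero_iff_mem] at hz
    rw [Ideal.Quotient.eq_zero_iff_mem]
    refine reesShiftIdeal_mem_of_eval₂_mul_mem (hsingle hd' le_rfl) ?_ hP ?_
    · intro i a ha
      rw [hpow] at ha ⊢
      intro n hn
      have := ha (n + d) (by rw [add_mul]; omega)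
      rwa [MulMemClass.coe_mul, single, PowerSeries.coeff_X_pow_mul] at this
    · intro n
      rw [← hφ₀]
      exact hz n

end semigroupRing

end TangentCone

/-! ### Arithmetic of the Arslan semigroup -/

theorem mem_arslanSemigroup_of_eq {m a b c d n : ℕ}
    (h : n = a * (m * (m + 1)) + b * (m * (m + 1) + 1) + c * (m + 1) ^ 2
      + d * ((m + 1) ^ 2 + 1)) : n ∈ arslanSemigroup m := by
  have key : ∀ x ∈ ({m * (m + 1), m * (m + 1) + 1, (m + 1) ^ 2, (m + 1) ^ 2 + 1} : Set ℕ),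
      ∀ e : ℕ, e * x ∈ arslanSemigroup m := fun x hx e => by
    rw [← smul_eq_mul]
    exact AddSubmonoid.nsmul_mem _ (AddSubmonoid.subset_closure hx) e
  rw [h]
  exact add_mem (add_mem (add_mem (key _ (by simp) a) (key _ (by simp) b)) (key _ (by simp) c))
    (key _ (by simp) d)

theorem exists_eq_of_mem_arslanSemigroup {m n : ℕ} (h : n ∈ arslanSemigroup m) :
    ∃ a b c d, n = a * (m * (m + 1)) + b * (m * (m + 1) + 1) + c * (m + 1) ^ 2
      + d * ((m + 1) ^ 2 + 1) := by
  induction h using AddSubmonoid.closure_induction with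
  | mem x hx =>
    simp only [Set.mem_insert_iff, Set.mem_singleton_iff] at hx
    rcases hx with rfl | rfl | rfl | rfl
    · exact ⟨1, 0, 0, 0, by ring⟩
    · exact ⟨0, 1, 0, 0, by ring⟩
    · exact ⟨0, 0, 1, 0, by ring⟩
    · exact ⟨0, 0, 0, 1, by ring⟩
  | zero => exact ⟨0, 0, 0, 0, by ring⟩
  | add x y _ _ hx hy =>
    obtain ⟨a, b, c, d, rfl⟩ := hx
    obtain ⟨a', b', c', d', rfl⟩ := hy
    exact ⟨a + a', b + b', c + c', d + d', by ring⟩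

/-- An element of the Arslan semigroup that is at least `i` times the multiplicity is a sum of at
least `i` generators. -/
theorem exists_le_add_of_mem_arslanSemigroup {m n i : ℕ} (h : n ∈ arslanSemigroup m)
    (hi : i * (m * (m + 1)) ≤ n) :
    ∃ a b c d, i ≤ a + b + c + d ∧ n = a * (m * (m + 1)) + b * (m * (m + 1) + 1)
      + c * (m + 1) ^ 2 + d * ((m + 1) ^ 2 + 1) := by
  obtain ⟨a, b, c, d, rfl⟩ := exists_eq_of_mem_arslanSemigroup h
  rcases le_or_gt i (a + b + c + d) with hl | hl
  · exact ⟨a, b, c, d, hl, rfl⟩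
  obtain ⟨j, rfl⟩ := Nat.exists_eq_add_of_lt hl
  obtain ⟨u, hu⟩ := Nat.exists_eq_add_of_le hi
  -- The generators exceed `m(m+1)` by `0, 1, m+1, m+2`; here `j + 1` summands are missing and `u`
  -- is the excess of the element over `i * (m(m+1))`.
  have hu' : u + (j + 1) * m * (m + 1) = b + c * (m + 1) + d * (m + 2) := by nlinarith
  rcases le_or_gt ((j + 1) * m) c with hc | hc
  -- Since `m · n₃ = (m+1) · n₁`, trading `(j+1)m` copies of `n₃` gains `j + 1` summands.
  · obtain ⟨e, rfl⟩ := Nat.exists_eq_add_of_le hc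
    have he : u = b + e * (m + 1) + d * (m + 2) := by nlinarith
    refine ⟨a + (j + 1) * m + j + 1, b, e, d, by omega, ?_⟩
    rw [hu, he]
    ring
  rcases le_or_gt ((j + 1) * m) (c + d) with hd | hd
  -- The same trade, completed by `e + 1` copies of `n₄ = n₃ + 1`; their extra units turn `e + 1` of
  -- the new `n₁` into `n₂ = n₁ + 1`.
  · obtain ⟨e, he⟩ := Nat.exists_eq_add_of_lt hc
    obtain ⟨v, rfl⟩ : ∃ v, d = e + 1 + v := Nat.exists_eq_add_of_le (by omega)
    rw [he] at hu'
    have hv : u = b + (e + 1) + v * (m + 2) := by nlinarith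
    refine ⟨a + c + j + 1, b + (e + 1), 0, v, by omega, ?_⟩
    rw [hu, hv]
    ring
  -- Now `u` is at most `b + d`, hence at most `i`, so `i - u` copies of `n₁` and `u` copies of `n₂`
  -- suffice.
  · have hub : u ≤ b + d := by nlinarith
    obtain ⟨w, hw⟩ := Nat.exists_eq_add_of_le hub
    refine ⟨a + c + w + j + 1, u, 0, 0, by omega, ?_⟩
    rw [hu, show a + b + c + d + j + 1 = a + c + w + j + 1 + u by omega]
    ring

/-- The four generators of the Arslan semigroup. -/
def arslanGenerator (m : ℕ) : Fin 4 → ℕ :=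
  ![m * (m + 1), m * (m + 1) + 1, (m + 1) ^ 2, (m + 1) ^ 2 + 1]

theorem arslanGenerator_mem (m : ℕ) (j : Fin 4) : arslanGenerator m j ∈ arslanSemigroup m := by
  apply AddSubmonoid.subset_closure
  fin_cases j <;> simp [arslanGenerator]

theorem le_arslanGenerator (m : ℕ) (j : Fin 4) : m * (m + 1) ≤ arslanGenerator m j := by
  fin_cases j <;> simp [arslanGenerator] <;> nlinarith

theorem le_of_mem_arslanSemigroup {m n : ℕ} (h : n ∈ arslanSemigroup m) (h0 : n ≠ 0) :
    m * (m + 1) ≤ n := by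
  suffices n = 0 ∨ m * (m + 1) ≤ n from this.resolve_left h0
  clear h0
  induction h using AddSubmonoid.closure_induction with
  | mem x hx =>
    simp only [Set.mem_insert_iff, Set.mem_singleton_iff] at hx
    right
    rcases hx with rfl | rfl | rfl | rfl <;> nlinarith
  | zero => exact Or.inl rfl
  | add x y _ _ hx hy => omega

theorem exists_arslanGenerator_add {m n i : ℕ} (h : n ∈ arslanSemigroup m)
    (hi : (i + 1) * (m * (m + 1)) ≤ n) :
    ∃ j, ∃ s ∈ arslanSemigroup m, n = arslanGenerator m j + s ∧ i * (m * (m + 1)) ≤ s := by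
  obtain ⟨a, b, c, d, hl, rfl⟩ := exists_le_add_of_mem_arslanSemigroup h hi
  have bound : ∀ a b c d : ℕ, i ≤ a + b + c + d → i * (m * (m + 1)) ≤ a * (m * (m + 1))
      + b * (m * (m + 1) + 1) + c * (m + 1) ^ 2 + d * ((m + 1) ^ 2 + 1) := fun a b c d h =>
    (Nat.mul_le_mul_right _ h).trans (by nlinarith)
  rcases a with _ | a
  · rcases b with _ | b
    · rcases c with _ | c
      · rcases d with _ | d
        · omega
        · exact ⟨3, _, mem_arslanSemigroup_of_eq (a := 0) (b := 0) (c := 0) (d := d) rfl,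
            by simp [arslanGenerator]; ring, bound _ _ _ _ (by omega)⟩
      · exact ⟨2, _, mem_arslanSemigroup_of_eq (a := 0) (b := 0) (c := c) (d := d) rfl,
          by simp [arslanGenerator]; ring, bound _ _ _ _ (by omega)⟩
    · exact ⟨1, _, mem_arslanSemigroup_of_eq (a := 0) (b := b) (c := c) (d := d) rfl,
        by simp [arslanGenerator]; ring, bound _ _ _ _ (by omega)⟩
  · exact ⟨0, _, mem_arslanSemigroup_of_eq (a := a) (b := b) (c := c) (d := d) rfl,
      by simp [arslanGenerator]; ring, bound _ _ _ _ (by omega)⟩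

theorem mainTheorem4 (k : Type*) [Field k] (m : ℕ) (hm : 2 ≤ m) :
    IsCohenMacaulayRing (TangentCone (semigroupRing k (arslanSemigroup m))) :=
  semigroupRing.isCohenMacaulayRing_tangentCone (arslanGenerator_mem m) (d := m * (m + 1))
    (by positivity) (AddSubmonoid.subset_closure (by simp)) (le_arslanGenerator m)
    (fun _ => le_of_mem_arslanSemigroup) (fun _ _ => exists_arslanGenerator_add)
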